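/- Let $F_n$ be the Fibonacci numbers ($F_0=0$, $F_1=1$, $F_n=F_{n-1}+F_{n-2}$) and $L_n$ the Lucas numbers ($L_0=2$, $L_1=1$, $L_n=L_{n-1}+L_{n-2}$). For positive integers $a_1,\dots,a_l$ with $\gcd(a_1,\dots,a_l)=1$ and an integer $p\ge 0$, let $g_p(a_1,\dots,a_l)$ (the $p$-Frobenius number) be the largest integer $n$ for which the equation $a_1x_1+\cdots+a_lx_l=n$ has at most $p$ solutions in nonnegative integers $x_1,\dots,x_l$. For $i\ge 3$ we have \begin{align*} g_3(L_i,L_{i+2},L_{i+k})&=(4L_i-1)L_{i+2}-L_i\quad(k\ge i+5),\\ g_3(L_i,L_{i+2},L_{2i+4})&=(4F_{i-1}-F_{i-2}-1)L_{i+2}+L_{2i+4}-L_i,\\ g_3(L_i,L_{i+2},L_{2i+3})&=(4F_{i+1}-1)L_{i+2}-L_i,\\ g_3(L_i,L_{i+2},L_{2i+2})&=(F_i+2F_{i-3}-1)L_{i+2}+2L_{2i+2}-L_i,\\ g_3(L_i,L_{i+2},L_{2i+1})&=(F_{i-1}-1)L_{i+2}+3L_{2i+1}-L_i,\\ g_3(L_i,L_{i+2},L_{2i})&=\begin{cases}(2F_{i-3}-1)L_{i+2}+4L_{2i}-L_i&(i\ge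 4),\\ 3L_{i+2}+2L_{2i}-L_i\ (=65)&(i=3).\end{cases} \end{align*} Moreover, let $k\ge 3$ and $r=\lfloor (L_i-1)/F_k\rfloor$. Then $r\ge 3$ if and only if $k\le i-1$, and in that case $$ g_3(L_i,L_{i+2},L_{i+k})=\begin{cases} (L_i-rF_k-1)L_{i+2}+(r+3)L_{i+k}-L_i&\text{if }(L_i-rF_k)L_{i+2}\ge F_{k-2}L_i,\\ (F_k-1)L_{i+2}+(r+2)L_{i+k}-L_i&\text{if }(L_i-rF_k)L_{i+2}<F_{k-2}L_i. \end{cases} $$ -/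

import Mathlib

/-- The Lucas numbers: `L 0 = 2`, `L 1 = 1`, `L (n + 2) = L (n + 1) + L n`. -/
def lucas : ℕ → ℕ
  | 0 => 2
  | 1 => 1
  | n + 2 => lucas (n + 1) + lucas n

/-- The number of representations `d(n; a₁, …, a_l)` of the integer `n` as
`a₁ x₁ + ⋯ + a_l x_l` with nonnegative integers `x₁, …, x_l`. -/
noncomputable def numReps {l : ℕ} (a : Fin l → ℕ) (n : ℤ) : ℕ∞ :=
  Set.encard {x : Fin l → ℕ | ∑ j, (a j : ℤ) * (x j : ℤ) = n}

/-- `g` is the `p`-Frobenius number `g_p(a₁, …, a_l)`: the largest integer that has at most `p`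
representations as a nonnegative integer combination of `a₁, …, a_l`. -/
def IsPFrobeniusNumber (p : ℕ) {l : ℕ} (a : Fin l → ℕ) (g : ℤ) : Prop :=
  IsGreatest {n : ℤ | numReps a n ≤ (p : ℕ∞)} g

/-! Put a = L_i, b = L_{i+2}, c = L_{i+k}. By `lucas_add_eq_sub`, c = f b - e a with f = F_k and e =
F_{k-2}, so n = a x + b y + c z reads n = b u + a (x - e z) with u = y + f z. As a and b are
coprime, n fixes u modulo a. Writing u = j + s a with 0 ≤ j < a, representations of n correspond to
pairs (s, z) with z ≥ 0, f z ≤ u and cost b u - e a z ≤ n. Hence g_3 + a is the maximum over j of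
the fourth smallest cost. `isPFrobeniusNumber_of_criterion` certifies a cost b U - e a z₀ as this
maximum: every residue has four pairs costing no more, and the residue of U has at most three
strictly cheaper ones.

For k ≤ i - 1, dividing a by f organizes the pairs uniformly (`exists_four_of_three_le`). For k ≥ i,
few multiples of f lie below U, and a short case analysis in X = F_i, Y = F_{i-1} suffices, using
3/2 ≤ X/Y ≤ 2. -/

/-- Criterion for the `p`-Frobenius number of `(a, b, c)` with `c = f b - e a`. A representation
with coefficients `(x, y, z)` is recorded by `z` and by `u = y + f z`, for which
`b y + c z = b u - e a z`. -/
theorem isPFrobeniusNumber_of_criterion {p A B C : ℕ} {e f U z₀ : ℤ} (hA : 0 < A)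
    (hcop : IsCoprime (A : ℤ) (B : ℤ)) (hC : (C : ℤ) = f * B - e * A)
    (upper : ∀ j : ℤ, 0 ≤ j → j < A → ∃ S : Finset (ℤ × ℤ), p < S.card ∧ ∀ q ∈ S,
      0 ≤ q.2 ∧ f * q.2 ≤ j + q.1 * A ∧ B * (j + q.1 * A) - e * A * q.2 ≤ B * U - e * A * z₀)
    (lower : ∃ T : Finset (ℤ × ℤ), T.card ≤ p ∧ ∀ s z : ℤ, 0 ≤ z → f * z ≤ U + s * A →
      B * s < e * (z - z₀) → (s, z) ∈ T) :
    IsPFrobeniusNumber p ![A, B, C] (B * U - e * A * z₀ - A) := by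
  have hA' : (0 : ℤ) < A := by exact_mod_cast hA
  constructor
  · obtain ⟨T, hT, hmem⟩ := lower
    have key : ∀ x : Fin 3 → ℕ,
        ∑ j, ((![A, B, C] j : ℕ) : ℤ) * (x j : ℤ) = B * U - e * A * z₀ - A →
        ∃ s : ℤ, (x 1 : ℤ) + f * x 2 = U + s * A ∧ (x 0 : ℤ) + 1 = e * (x 2 - z₀) - B * s := by
      intro x hx
      simp only [Fin.sum_univ_three, Matrix.cons_val_zero, Matrix.cons_val_one,
        Matrix.cons_val, hC] at hx
      have h1 : (A : ℤ) * (e * (x 2 - z₀) - (x 0 + 1)) = B * (x 1 + f * x 2 - U) := by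
        linear_combination -hx
      obtain ⟨s, hs⟩ := hcop.dvd_of_dvd_mul_left (Dvd.intro _ h1)
      refine ⟨s, by linear_combination hs, ?_⟩
      rw [hs] at h1
      have h2 := mul_left_cancel₀ hA'.ne' (h1.trans (by ring : _ = (A : ℤ) * (B * s)))
      linear_combination -h2
    change Set.encard _ ≤ (p : ℕ∞)
    refine le_trans (Set.encard_le_encard_of_injOn (t := (T : Set (ℤ × ℤ)))
      (f := fun x => (((x 1 : ℤ) + f * x 2 - U) / A, (x 2 : ℤ))) ?_ ?_) ?_
    · intro x hx
      obtain ⟨s, h1, h2⟩ := key x hx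
      have h3 : ((x 1 : ℤ) + f * x 2 - U) / A = s := by
        rw [show (x 1 : ℤ) + f * x 2 - U = s * A by linear_combination h1]
        exact Int.mul_ediv_cancel _ hA'.ne'
      simp only [h3, Finset.mem_coe]
      apply hmem _ _ (by positivity)
      · linarith [Int.natCast_nonneg (x 1)]
      · linarith [Int.natCast_nonneg (x 0)]
    · intro x hx y hy hxy
      obtain ⟨s, h1, h2⟩ := key x hx
      obtain ⟨s', h1', h2'⟩ := key y hy
      simp only [Prod.mk.injEq] at hxy
      obtain ⟨hs, hz⟩ := hxy
      rw [show (x 1 : ℤ) + f * x 2 - U = s * A by linear_combination h1,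
        show (y 1 : ℤ) + f * y 2 - U = s' * A by linear_combination h1',
        Int.mul_ediv_cancel _ hA'.ne', Int.mul_ediv_cancel _ hA'.ne'] at hs
      subst hs
      have hy1 : (x 1 : ℤ) = y 1 := by linear_combination h1 - h1' - f * hz
      have hy0 : (x 0 : ℤ) = y 0 := by linear_combination h2 - h2' + e * hz
      funext t
      fin_cases t
      · exact_mod_cast hy0
      · exact_mod_cast hy1
      · exact_mod_cast hz
    · rw [Set.encard_coe_eq_coe_finsetCard]
      exact_mod_cast hT
  · intro n hn
    by_contra hlt
    rw [not_le] at hlt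
    have hn' : Set.encard {x : Fin 3 → ℕ |
      ∑ j, ((![A, B, C] j : ℕ) : ℤ) * (x j : ℤ) = n} ≤ (p : ℕ∞) := hn
    obtain ⟨v, w, hvw⟩ := hcop
    -- `w` inverts `B` modulo `A`, so this is the residue of u forced by n.
    obtain ⟨S, hS, hmem⟩ := upper ((w * n) % A) (Int.emod_nonneg _ hA'.ne')
      (Int.emod_lt_of_pos _ hA')
    set j := (w * n) % A with hj
    have hjn : ∃ m : ℤ, n = B * j + A * m := by
      refine ⟨v * n + B * (w * n / A), ?_⟩
      have := Int.emod_add_mul_ediv (w * n) A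
      rw [← hj] at this
      linear_combination (-n) * hvw - B * this
    obtain ⟨m, hm⟩ := hjn
    have hx : ∀ q ∈ S, 0 ≤ q.2 ∧ 0 ≤ j + q.1 * A - f * q.2 ∧ 0 ≤ m - B * q.1 + e * q.2 := by
      intro q hq
      obtain ⟨h1, h2, h3⟩ := hmem q hq
      refine ⟨h1, by linarith, ?_⟩
      by_contra hneg
      -- A negative coefficient of `A` would put n at least `A` below the cost of `q`, contradicting
      -- n > B U - e A z₀ - A.
      have h4 : m - B * q.1 + e * q.2 + 1 ≤ 0 := by omega
      have h5 := mul_nonpos_of_nonneg_of_nonpos hA'.le h4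
      nlinarith
    have hle : (S : Set (ℤ × ℤ)).encard ≤ Set.encard {x : Fin 3 → ℕ |
        ∑ j, ((![A, B, C] j : ℕ) : ℤ) * (x j : ℤ) = n} := by
      refine Set.encard_le_encard_of_injOn (f := fun q =>
        ![(m - B * q.1 + e * q.2).toNat, (j + q.1 * A - f * q.2).toNat, q.2.toNat]) ?_ ?_
      · intro q hq
        obtain ⟨h1, h2, h3⟩ := hx q hq
        simp only [Set.mem_ofPred_eq, Fin.sum_univ_three, Matrix.cons_val_zero,
          Matrix.cons_val_one, Matrix.cons_val, Int.toNat_of_nonneg h1,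
          Int.toNat_of_nonneg h2, Int.toNat_of_nonneg h3, hC, hm]
        ring
      · intro q hq q' hq' hqq
        obtain ⟨h1, h2, h3⟩ := hx q hq
        obtain ⟨h1', h2', h3'⟩ := hx q' hq'
        have e1 := congrFun hqq 1
        have e2 := congrFun hqq 2
        simp only [Matrix.cons_val_one, Matrix.cons_val] at e1 e2
        have e2' : q.2 = q'.2 := by omega
        have e1' : j + q.1 * A - f * q.2 = j + q'.1 * A - f * q'.2 := by omega
        rw [e2'] at e1'
        refine Prod.ext (mul_right_cancel₀ hA'.ne' (by linarith : q.1 * (A : ℤ) = q'.1 * A)) e2'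
    rw [Set.encard_coe_eq_coe_finsetCard] at hle
    have := hle.trans hn'
    rw [Nat.cast_le] at this
    omega

/-! ### Lucas and Fibonacci identities -/

/-- In `k`, both sides satisfy the Fibonacci recurrence. -/
theorem lucas_add_two_mul (i : ℕ) : ∀ k : ℕ,
    lucas (i + (k + 2)) + Nat.fib k * lucas i = Nat.fib (k + 2) * lucas (i + 2)
  | 0 => by simp
  | 1 => by
    have h : lucas (i + 3) = lucas (i + 2) + lucas (i + 1) := rfl
    have h' : lucas (i + 2) = lucas (i + 1) + lucas i := rfl
    have h3 : Nat.fib 3 = 2 := rfl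
    simp only [Nat.reduceAdd, Nat.fib_one, h3]
    omega
  | k + 2 => by
    have h1 := lucas_add_two_mul i k
    have h2 := lucas_add_two_mul i (k + 1)
    have h : lucas (i + (k + 2 + 2)) = lucas (i + (k + 1 + 2)) + lucas (i + (k + 2)) := rfl
    have f1 : Nat.fib (k + 2 + 2) = Nat.fib (k + 2) + Nat.fib (k + 1 + 2) := Nat.fib_add_two
    have f2 : Nat.fib (k + 2) = Nat.fib k + Nat.fib (k + 1) := Nat.fib_add_two
    rw [h, f1, add_mul, ← h1, ← h2]
    linear_combination lucas i * f2

theorem lucas_add_eq_sub (i k : ℕ) (hk : 2 ≤ k) :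
    (lucas (i + k) : ℤ) = Nat.fib k * lucas (i + 2) - Nat.fib (k - 2) * lucas i := by
  obtain ⟨k, rfl⟩ := Nat.exists_eq_add_of_le' hk
  rw [Nat.add_sub_cancel]
  have := lucas_add_two_mul i k
  zify at this
  linear_combination this

theorem lucas_add_one_eq_fib : ∀ m : ℕ, lucas (m + 1) = Nat.fib m + Nat.fib (m + 2)
  | 0 => rfl
  | 1 => rfl
  | m + 2 => by
    have h : lucas (m + 2 + 1) = lucas (m + 1 + 1) + lucas (m + 1) := rfl
    have f1 : Nat.fib (m + 2 + 2) = Nat.fib (m + 2) + Nat.fib (m + 1 + 2) := Nat.fib_add_two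
    have f2 : Nat.fib (m + 2) = Nat.fib m + Nat.fib (m + 1) := Nat.fib_add_two
    rw [h, lucas_add_one_eq_fib m, lucas_add_one_eq_fib (m + 1)]
    omega

theorem coprime_lucas_succ : ∀ n : ℕ, Nat.Coprime (lucas n) (lucas (n + 1))
  | 0 => by decide
  | n + 1 => by
    have h : lucas (n + 1 + 1) = lucas (n + 1) + lucas n := rfl
    rw [h, Nat.coprime_self_add_right]
    exact (coprime_lucas_succ n).symm

theorem isCoprime_lucas_add_two (n : ℕ) : IsCoprime (lucas n : ℤ) (lucas (n + 2) : ℤ) := by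
  have h : lucas (n + 2) = lucas (n + 1) + lucas n := rfl
  rw [Nat.isCoprime_iff_coprime, h, Nat.coprime_add_self_right]
  exact coprime_lucas_succ n

/-- All Fibonacci and Lucas numbers near `i` in terms of `X = F_i` and `Y = F_{i-1}`. -/
theorem exists_fib_lucas_coordinates {i : ℕ} (hi : 3 ≤ i) : ∃ X Y : ℤ,
    (Nat.fib (i - 3) : ℤ) = 2 * Y - X ∧ (Nat.fib (i - 2) : ℤ) = X - Y ∧
    (Nat.fib (i - 1) : ℤ) = Y ∧ (Nat.fib i : ℤ) = X ∧ (Nat.fib (i + 1) : ℤ) = X + Y ∧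
    (Nat.fib (i + 2) : ℤ) = 2 * X + Y ∧ (Nat.fib (i + 3) : ℤ) = 3 * X + 2 * Y ∧
    (Nat.fib (i + 4) : ℤ) = 5 * X + 3 * Y ∧ (Nat.fib (i + 5) : ℤ) = 8 * X + 5 * Y ∧
    (lucas i : ℤ) = X + 2 * Y ∧ (lucas (i + 2) : ℤ) = 4 * X + 3 * Y ∧
    1 ≤ Y ∧ 3 * Y ≤ 2 * X ∧ X ≤ 2 * Y ∧ (4 ≤ i → 3 * X ≤ 5 * Y ∧ X < 2 * Y) := by
  obtain ⟨m, rfl⟩ := Nat.exists_eq_add_of_le' hi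
  have h (n : ℕ) : Nat.fib (n + 2) = Nat.fib n + Nat.fib (n + 1) := Nat.fib_add_two
  have h2 := h m
  have h3 := h (m + 1)
  have h4 := h (m + 2)
  have h5 := h (m + 3)
  have h6 := h (m + 4)
  have h7 := h (m + 5)
  have h8 := h (m + 6)
  have l1 := lucas_add_one_eq_fib (m + 2)
  have l2 := lucas_add_one_eq_fib (m + 4)
  have hp : 0 < Nat.fib (m + 1) := Nat.fib_pos.2 (by omega)
  have hmono : Nat.fib m ≤ Nat.fib (m + 1) := Nat.fib_mono (by omega)
  have hm : 4 ≤ m + 3 → Nat.fib (m + 1) ≤ 2 * Nat.fib m ∧ 0 < Nat.fib m := by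
    intro hm
    obtain ⟨n, rfl⟩ := Nat.exists_eq_add_of_le' (show 1 ≤ m by omega)
    have h0 : Nat.fib (n + 1 + 1) = Nat.fib n + Nat.fib (n + 1) := h n
    have hmono : Nat.fib n ≤ Nat.fib (n + 1) := Nat.fib_mono (by omega)
    have : 0 < Nat.fib (n + 1) := Nat.fib_pos.2 (by omega)
    omega
  simp only [Nat.add_assoc, Nat.reduceAdd] at *
  rw [show m + 3 - 3 = m by omega, show m + 3 - 2 = m + 1 by omega,
    show m + 3 - 1 = m + 2 by omega]
  refine ⟨Nat.fib (m + 3), Nat.fib (m + 2), ?_⟩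
  refine ⟨?_, ?_, rfl, rfl, ?_, ?_, ?_, ?_, ?_, ?_, ?_, ?_, ?_, ?_, fun h4 => ?_⟩
  all_goals omega

/-! ### Bounds on the parameters and the range k ≤ i - 1 -/

/-- The parameters `(s, z)` of a representation below `b U - e a z₀`. -/
theorem parameter_bounds {a b e f U z₀ s z n : ℤ} (ha : 0 < a) (hf : 0 < f) (he : 0 ≤ e)
    (hc : 0 < f * b - e * a) (hU : e * (U - f * z₀) ≤ f * b - e * a) (hn : U < n * a)
    (hz : 0 ≤ z) (h1 : f * z ≤ U + s * a) (h2 : b * s < e * (z - z₀)) :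
    -n < s ∧ s ≤ 0 ∧ (s = 0 → z₀ < z) := by
  refine ⟨?_, ?_, ?_⟩
  · by_contra h
    have := mul_nonneg hf.le hz
    have := mul_nonneg ha.le (by linarith : 0 ≤ -n - s)
    nlinarith
  · by_contra h
    have hs : 1 ≤ s := by omega
    -- Eliminating z from `h1` and `h2` gives (f b - e a) s < e (U - f z₀) ≤ f b - e a, impossible
    -- for s ≥ 1.
    have h3 := mul_le_mul_of_nonneg_left h1 he
    have h4 := mul_lt_mul_of_pos_left h2 hf
    have h5 := mul_nonneg hc.le (by linarith : 0 ≤ s - 1)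
    nlinarith
  · rintro rfl
    by_contra h
    have := mul_nonneg he (by linarith : 0 ≤ z₀ - z)
    linarith

/-- Write j = y + f z with 0 ≤ y < f. Lowering the third coefficient by one raises the cost by e a ≤
c. If z ≥ 3, four pairs with s = 0 suffice; otherwise take the z + 1 pairs with s = 0 and 3 - z with
s = 1. The two bounds on `M` are the worst cases. The remainder `q` lies in 1, …, f, not 0, …, f -
1, because r is the quotient of a - 1. -/
theorem exists_four_of_three_le {a b c e f q r M : ℤ} (hf : 0 < f) (hq : 1 ≤ q) (hqf : q ≤ f)
    (ha : a = r * f + q) (hr : 3 ≤ r) (hc : c = f * b - e * a) (hec : e * a ≤ c)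
    (hea : 0 ≤ e * a) (hb : 0 ≤ b) (hM₁ : b * (q - 1) + c * (r + 3) ≤ M)
    (hM₂ : b * (f - 1) + c * (r + 2) ≤ M) (j : ℤ) (hj : 0 ≤ j) (hja : j < a) :
    ∃ S : Finset (ℤ × ℤ), 3 < S.card ∧ ∀ q ∈ S,
      0 ≤ q.2 ∧ f * q.2 ≤ j + q.1 * a ∧ b * (j + q.1 * a) - e * a * q.2 ≤ M := by
  obtain ⟨y, z, hjyz, hy, hyf⟩ : ∃ y z, j = y + f * z ∧ 0 ≤ y ∧ y < f :=
    ⟨j % f, j / f, (Int.emod_add_mul_ediv j f).symm, Int.emod_nonneg _ hf.ne',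
      Int.emod_lt_of_pos _ hf⟩
  have hz : 0 ≤ z := by
    by_contra h
    nlinarith [mul_nonneg hf.le (by omega : 0 ≤ -1 - z)]
  have hzr : z < r ∨ z = r ∧ y < q := by
    rcases lt_trichotomy z r with h | h | h
    · exact Or.inl h
    · refine Or.inr ⟨h, ?_⟩
      subst h
      linarith
    · exfalso
      nlinarith [mul_nonneg hf.le (by omega : 0 ≤ z - r - 1)]
  generalize hP : e * a = P at *
  have hyb := mul_nonneg hb (by linarith : 0 ≤ f - 1 - y)
  have hc0 : 0 ≤ c := by linarith
  have hcr := mul_nonneg hc0 (by linarith : 0 ≤ r - 3)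
  have hqb := mul_nonneg hb (by linarith : 0 ≤ q - 1)
  have hfb : f * b = c + P := by linarith
  have hcard {p₁ p₂ p₃ p₄ : ℤ × ℤ} (h : p₁ ≠ p₂ ∧ p₁ ≠ p₃ ∧ p₁ ≠ p₄ ∧ p₂ ≠ p₃ ∧ p₂ ≠ p₄ ∧
      p₃ ≠ p₄) : 3 < ({p₁, p₂, p₃, p₄} : Finset (ℤ × ℤ)).card := by
    rw [Finset.card_insert_of_notMem, Finset.card_insert_of_notMem, Finset.card_pair] <;>
      simp [h]
  have hlow (m : ℤ) (h0 : 0 ≤ m) (hmz : m ≤ z) (h3 : m ≤ 3) :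
      0 ≤ z - m ∧ f * (z - m) ≤ j + 0 * a ∧ b * (j + 0 * a) - P * (z - m) ≤ M := by
    have h1 : b * (j + 0 * a) - P * (z - m) = b * y + c * z + P * m := by
      rw [hjyz]; linear_combination z * hfb
    have h2 := mul_nonneg hea (by linarith : 0 ≤ 3 - m)
    refine ⟨by linarith, by nlinarith [mul_nonneg hf.le h0], ?_⟩
    rw [h1]
    rcases hzr with h | ⟨rfl, h⟩
    · nlinarith [mul_nonneg hc0 (by linarith : 0 ≤ r - 1 - z)]
    · nlinarith [mul_nonneg hb (by linarith : 0 ≤ q - 1 - y)]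
  -- `v` is the largest third coefficient for s = 1; it is z + r, or z + r + 1 when y + q carries
  -- past f.
  have hhigh : ∃ v : ℤ, 2 ≤ v ∧ ∀ m : ℤ, 0 ≤ m → z + m ≤ 2 →
      0 ≤ v - m ∧ f * (v - m) ≤ j + 1 * a ∧ b * (j + 1 * a) - P * (v - m) ≤ M := by
    rcases lt_or_ge (y + q) f with h | h
    · refine ⟨z + r, by linarith, fun m h0 hm => ⟨by linarith, ?_, ?_⟩⟩
      · rw [hjyz, ha]
        nlinarith [mul_nonneg hf.le h0]
      · have h1 : b * (j + 1 * a) - P * (z + r - m) = b * (y + q) + c * (z + r) + P * m := by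
          rw [hjyz, ha]; linear_combination (z + r) * hfb
        rw [h1]
        have h2 := mul_nonneg h0 (by linarith : 0 ≤ c - P)
        have h3 := mul_nonneg hc0 (by linarith : 0 ≤ 2 - z - m)
        have h4 := mul_nonneg hb (by linarith : 0 ≤ f - 1 - (y + q))
        linarith
    · refine ⟨z + r + 1, by linarith, fun m h0 hm => ⟨by linarith, ?_, ?_⟩⟩
      · rw [hjyz, ha]
        nlinarith [mul_nonneg hf.le h0]
      · have h1 : b * (j + 1 * a) - P * (z + r + 1 - m)
            = b * (y + q - f) + c * (z + r + 1) + P * m := by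
          rw [hjyz, ha]; linear_combination (z + r + 1) * hfb
        rw [h1]
        have h2 := mul_nonneg h0 (by linarith : 0 ≤ c - P)
        have h3 := mul_nonneg hc0 (by linarith : 0 ≤ 2 - z - m)
        nlinarith
  obtain ⟨v, hv, hhigh⟩ := hhigh
  have hcases : z = 0 ∨ z = 1 ∨ z = 2 ∨ 3 ≤ z := by omega
  rcases hcases with h | h | h | h
  · refine ⟨{(0, z - 0), (1, v - 0), (1, v - 1), (1, v - 2)}, hcard (by simp; try omega), ?_⟩
    simp only [Finset.forall_mem_insert, Finset.mem_singleton, forall_eq]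
    exact ⟨hlow 0 (by omega) (by omega) (by omega), hhigh 0 (by omega) (by omega),
      hhigh 1 (by omega) (by omega), hhigh 2 (by omega) (by omega)⟩
  · refine ⟨{(0, z - 0), (0, z - 1), (1, v - 0), (1, v - 1)}, hcard (by simp; try omega), ?_⟩
    simp only [Finset.forall_mem_insert, Finset.mem_singleton, forall_eq]
    exact ⟨hlow 0 (by omega) (by omega) (by omega), hlow 1 (by omega) (by omega) (by omega),
      hhigh 0 (by omega) (by omega), hhigh 1 (by omega) (by omega)⟩
  · refine ⟨{(0, z - 0), (0, z - 1), (0, z - 2), (1, v - 0)}, hcard (by simp; try omega), ?_⟩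
    simp only [Finset.forall_mem_insert, Finset.mem_singleton, forall_eq]
    exact ⟨hlow 0 (by omega) (by omega) (by omega), hlow 1 (by omega) (by omega) (by omega),
      hlow 2 (by omega) (by omega) (by omega), hhigh 0 (by omega) (by omega)⟩
  · refine ⟨{(0, z - 0), (0, z - 1), (0, z - 2), (0, z - 3)}, hcard (by simp; try omega), ?_⟩
    simp only [Finset.forall_mem_insert, Finset.mem_singleton, forall_eq]
    exact ⟨hlow 0 (by omega) (by omega) (by omega), hlow 1 (by omega) (by omega) (by omega),
      hlow 2 (by omega) (by omega) (by omega), hlow 3 (by omega) (by omega) (by omega)⟩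

/-- Below `b U - e a z₀` there are at most three representations when `z₀` is the largest possible
third coefficient for `U` and `U - a < 3 f`. -/
theorem exists_three_of_lt {a b e f U z₀ : ℤ} (ha : 0 < a) (hf : 0 < f) (he : 0 ≤ e)
    (hc : 0 < f * b - e * a) (hfe : e * f ≤ f * b - e * a) (hz₀ : U < f * (z₀ + 1))
    (hU : U < 2 * a) (hU' : U < a + 3 * f) :
    ∃ T : Finset (ℤ × ℤ), T.card ≤ 3 ∧ ∀ s z : ℤ, 0 ≤ z → f * z ≤ U + s * a →
      b * s < e * (z - z₀) → (s, z) ∈ T := by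
  refine ⟨{(-1, 0), (-1, 1), (-1, 2)}, by decide, fun s z hz h1 h2 => ?_⟩
  have hU₀ := mul_le_mul_of_nonneg_left (by linarith : U - f * z₀ ≤ f) he
  obtain ⟨h3, h4, h5⟩ := parameter_bounds ha hf he hc (hU₀.trans hfe) hU hz h1 h2
  obtain rfl | rfl : s = 0 ∨ s = -1 := by omega
  · nlinarith [mul_nonneg hf.le (by linarith [h5 rfl] : 0 ≤ z - (z₀ + 1))]
  · have : z < 3 := by
      by_contra h
      nlinarith [mul_nonneg hf.le (by omega : 0 ≤ z - 3)]
    simp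
    omega

/-- The threshold comes from 3 F_{i-1} < L_i = F_i + 2 F_{i-1} ≤ 3 F_i. -/
theorem three_le_div_fib_iff {i k : ℕ} (hi : 3 ≤ i) (hk : 3 ≤ k) :
    3 ≤ (lucas i - 1) / Nat.fib k ↔ k ≤ i - 1 := by
  obtain ⟨X, Y, -, -, h1, h0, -, -, -, -, -, hA, -, hY, hXY, hYX, -⟩ :=
    exists_fib_lucas_coordinates hi
  rw [Nat.le_div_iff_mul_le (Nat.fib_pos.2 (by omega))]
  constructor
  · intro h
    by_contra hlt
    have : Nat.fib i ≤ Nat.fib k := Nat.fib_mono (by omega)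
    omega
  · intro h
    have : Nat.fib k ≤ Nat.fib (i - 1) := Nat.fib_mono h
    omega

theorem lucas_pos : ∀ n : ℕ, 0 < lucas n
  | 0 => by decide
  | 1 => by decide
  | n + 2 => Nat.add_pos_left (lucas_pos (n + 1)) _

/-- The two bounds in `exists_four_of_three_le` differ by b q - e a with q = a - r f; its sign
selects the formula. -/
theorem isPFrobeniusNumber_lucas_of_lt {i k : ℕ} {r : ℤ} (hi : 3 ≤ i) (hk : 3 ≤ k)
    (hki : k ≤ i - 1) (hr : 3 ≤ r) (hq : r * Nat.fib k < lucas i)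
    (hqf : (lucas i : ℤ) ≤ (r + 1) * Nat.fib k) :
    ((Nat.fib (k - 2) : ℤ) * lucas i ≤ (lucas i - r * Nat.fib k) * lucas (i + 2) →
      IsPFrobeniusNumber 3 ![lucas i, lucas (i + 2), lucas (i + k)]
        ((lucas i - r * Nat.fib k - 1) * lucas (i + 2) + (r + 3) * lucas (i + k) - lucas i)) ∧
    ((lucas i - r * Nat.fib k) * lucas (i + 2) < (Nat.fib (k - 2) : ℤ) * lucas i →
      IsPFrobeniusNumber 3 ![lucas i, lucas (i + 2), lucas (i + k)]
        ((Nat.fib k - 1) * lucas (i + 2) + (r + 2) * lucas (i + k) - lucas i)) := by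
  obtain ⟨X, Y, -, -, -, hX, -, -, -, -, -, hA, hB, hY, hXY, hYX, -⟩ :=
    exists_fib_lucas_coordinates hi
  have hC := lucas_add_eq_sub i k (by omega)
  have hcop := isCoprime_lucas_add_two i
  have hA0 := lucas_pos i
  have hf0 : (1 : ℤ) ≤ Nat.fib k := by exact_mod_cast Nat.fib_pos.2 (by omega)
  have he0 : (0 : ℤ) ≤ Nat.fib (k - 2) := by positivity
  have hef : (Nat.fib (k - 2) : ℤ) ≤ Nat.fib k := by exact_mod_cast Nat.fib_mono (by omega)
  have hfX : (Nat.fib k : ℤ) ≤ X := by rw [← hX]; exact_mod_cast Nat.fib_mono (by omega)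
  have hAB : 2 * (lucas i : ℤ) ≤ lucas (i + 2) := by linarith
  have hABe : (lucas i : ℤ) + Nat.fib (k - 2) ≤ lucas (i + 2) := by linarith
  have hA1 : (0 : ℤ) < lucas i := by exact_mod_cast hA0
  clear hA hB
  generalize (Nat.fib k : ℤ) = f at *
  generalize (Nat.fib (k - 2) : ℤ) = e at *
  obtain ⟨q, hq'⟩ : ∃ q, (lucas i : ℤ) = r * f + q := ⟨_, (add_sub_cancel _ _).symm⟩
  have hea := mul_nonneg he0 hA1.le
  have h1 : e * lucas i ≤ f * lucas i := mul_le_mul_of_nonneg_right hef hA1.le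
  have h2 := mul_le_mul_of_nonneg_left hAB (by linarith : 0 ≤ f)
  have h3 := mul_le_mul_of_nonneg_left hABe (by linarith : 0 ≤ f)
  have h4 := mul_pos (by linarith : 0 < f) hA1
  have hec : e * lucas i ≤ lucas (i + k) := by rw [hC]; linarith
  have hrf := mul_nonneg (by linarith : 0 ≤ r - 3) (by linarith : 0 ≤ f)
  have hup := fun M => exists_four_of_three_le (M := M) (by linarith) (by linarith) (by linarith)
    hq' hr hC hec hea (by positivity)
  constructor
  · intro hge
    have key := isPFrobeniusNumber_of_criterion (p := 3) (U := q - 1 + f * (r + 3))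
      (z₀ := r + 3) hA0 hcop hC (hup _ ?_ ?_)
      (exists_three_of_lt hA1 (by linarith) he0 (by linarith) (by linarith) (by linarith)
        (by linarith) (by linarith))
    · convert key using 1
      linear_combination (r + 3) * hC + lucas (i + 2) * hq'
    · linear_combination (r + 3) * hC
    · linear_combination (r + 2) * hC + hge + lucas (i + 2) * hq'
  · intro hlt
    have hqf' : q < f := by
      by_contra h
      nlinarith
    have key := isPFrobeniusNumber_of_criterion (p := 3) (U := f - 1 + f * (r + 2))
      (z₀ := r + 2) hA0 hcop hC (hup _ ?_ ?_)
      (exists_three_of_lt hA1 (by linarith) he0 (by linarith) (by linarith) (by linarith)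
        (by linarith) (by linarith))
    · convert key using 1
      linear_combination (r + 2) * hC
    · linear_combination (r + 3) * hC + hlt - lucas (i + 2) * hq'
    · linear_combination (r + 2) * hC

/-! ### The range k ≥ i -/

/-- Here f ≥ 4a exceeds U = 4a - 1, so only z = 0 matters and the answer is that of the pair a, b.
-/
theorem isPFrobeniusNumber_lucas_add_of_add_five_le {i k : ℕ} (hi : 3 ≤ i) (hk : i + 5 ≤ k) :
    IsPFrobeniusNumber 3 ![lucas i, lucas (i + 2), lucas (i + k)]
      ((4 * lucas i - 1) * lucas (i + 2) - lucas i) := by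
  obtain ⟨X, Y, -, -, -, hX, -, -, -, -, hf, hA, hB, hY, hXY, hYX, -⟩ :=
    exists_fib_lucas_coordinates hi
  have hC := lucas_add_eq_sub i k (by omega)
  have hfX : (Nat.fib (i + 5) : ℤ) ≤ Nat.fib k := by exact_mod_cast Nat.fib_mono hk
  have he0 : (0 : ℤ) ≤ Nat.fib (k - 2) := by positivity
  have hef : 2 * (Nat.fib (k - 2) : ℤ) ≤ Nat.fib k := by
    have h1 : Nat.fib k = Nat.fib (k - 2) + Nat.fib (k - 1) := by
      obtain ⟨k, rfl⟩ := Nat.exists_eq_add_of_le' (show 2 ≤ k by omega)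
      exact Nat.fib_add_two
    have h2 : Nat.fib (k - 2) ≤ Nat.fib (k - 1) := Nat.fib_mono (by omega)
    omega
  rw [hf] at hfX
  have hA1 : (0 : ℤ) < lucas i := by linarith
  have hB1 : (0 : ℤ) < lucas (i + 2) := by linarith
  have hAB : 5 * (lucas i : ℤ) ≤ 2 * lucas (i + 2) := by linarith
  have hfA : 4 * (lucas i : ℤ) ≤ Nat.fib k := by linarith
  generalize (Nat.fib k : ℤ) = f at *
  generalize (Nat.fib (k - 2) : ℤ) = e at *
  have h1 := mul_le_mul_of_nonneg_left hAB he0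
  have h2 := mul_le_mul_of_nonneg_right hef hB1.le
  have h3 := mul_nonneg he0 hA1.le
  have h4 := mul_pos (by linarith : 0 < f) hB1
  have key := isPFrobeniusNumber_of_criterion (p := 3) (U := 4 * lucas i - 1)
    (z₀ := 0) (lucas_pos i) (isCoprime_lucas_add_two i) hC ?_ ?_
  · convert key using 1
    ring
  · intro j hj hja
    have h5 (t : ℤ) (h0 : 0 ≤ t) (h3 : t ≤ 3) : 0 ≤ (0 : ℤ) ∧ f * 0 ≤ j + t * lucas i ∧
        lucas (i + 2) * (j + t * lucas i) - e * lucas i * 0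
          ≤ lucas (i + 2) * (4 * lucas i - 1) - e * lucas i * 0 := by
      have h6 := mul_nonneg h0 hA1.le
      have h7 := mul_nonneg (by linarith : 0 ≤ 3 - t) hA1.le
      exact ⟨le_rfl, by linarith, by
        linarith [mul_nonneg hB1.le (by linarith : 0 ≤ 4 * lucas i - 1 - (j + t * lucas i))]⟩
    refine ⟨{(0, 0), (1, 0), (2, 0), (3, 0)}, by decide, ?_⟩
    simp only [Finset.forall_mem_insert, Finset.mem_singleton, forall_eq]
    exact ⟨h5 0 (by omega) (by omega), h5 1 (by omega) (by omega), h5 2 (by omega) (by omega),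
      h5 3 (by omega) (by omega)⟩
  · refine ⟨{(-1, 0), (-2, 0), (-3, 0)}, by decide, fun s z hz h1 h2 => ?_⟩
    obtain ⟨h5, h6, h7⟩ := parameter_bounds (n := 4) hA1 (by linarith) he0 (by nlinarith)
      (by nlinarith) (by linarith) hz h1 h2
    have hsA := mul_nonneg (by linarith : 0 ≤ -s) hA1.le
    have hz0 : z = 0 := by
      by_contra h
      nlinarith [mul_nonneg (by linarith : 0 ≤ f) (by omega : 0 ≤ z - 1)]
    have hs0 : s ≠ 0 := fun h => by have := h7 h; omega
    simp
    omega
-- The extremal residue is j = a - 1 at s = 3; exactly one multiple of c fits there, so z₀ = 1.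
theorem isPFrobeniusNumber_lucas_two_mul_add_four {i : ℕ} (hi : 3 ≤ i) :
    IsPFrobeniusNumber 3 ![lucas i, lucas (i + 2), lucas (2 * i + 4)]
      ((4 * Nat.fib (i - 1) - Nat.fib (i - 2) - 1) * lucas (i + 2)
        + lucas (2 * i + 4) - lucas i) := by
  obtain ⟨X, Y, h₃, h₂, h₁, h0, f1, f2, f3, f4, -, hA, hB, hY, hXY, hYX, h4⟩ :=
    exists_fib_lucas_coordinates hi
  have hC := lucas_add_eq_sub i (i + 4) (by omega)
  rw [show i + (i + 4) = 2 * i + 4 by omega, show i + 4 - 2 = i + 2 by omega, f4, f2] at hC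
  -- With P = 2Y - X and Q = 2X - 3Y, X = 3P + 2Q and Y = 2P + Q. Supplying the products of P and Q
  -- leaves only linear arithmetic for the quadratic cost comparisons.
  have hP : 0 ≤ 2 * Y - X := by linarith
  have hQ : 0 ≤ 2 * X - 3 * Y := by linarith
  have hPP := mul_nonneg hP hP
  have hPQ := mul_nonneg hP hQ
  have hQQ := mul_nonneg hQ hQ
  have hYY := mul_pos (by linarith : 0 < Y) (by linarith : 0 < Y)
  have hb : 0 ≤ 4 * X + 3 * Y := by linarith
  have key := isPFrobeniusNumber_of_criterion (p := 3) (U := 4 * (X + 2 * Y) - 1) (z₀ := 1)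
    (lucas_pos i) (isCoprime_lucas_add_two i) hC ?_ ?_
  · convert key using 1
    rw [h₂, h₁, hC, hA, hB]
    ring
  · rw [hA, hB]
    clear hC h₃ h₂ h₁ h0 f1 f2 f3 f4 hA hB h4
    have hb' {m n : ℤ} (h : m ≤ n) := mul_nonneg hb (sub_nonneg.2 h)
    intro j hj hja
    rcases le_or_gt (5 * X + 3 * Y) (j + 3 * (X + 2 * Y)) with hge1 | hlt1
    · refine ⟨{(0, 0), (1, 0), (2, 0), (3, 1)}, by decide, ?_⟩
      simp only [Finset.forall_mem_insert, Finset.mem_singleton, forall_eq]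
      refine ⟨?_, ?_, ?_, ?_⟩ <;>
        exact ⟨by norm_num, by linarith, by linarith [hb' hja, hb' hge1]⟩
    · refine ⟨{(0, 0), (1, 0), (2, 0), (3, 0)}, by decide, ?_⟩
      simp only [Finset.forall_mem_insert, Finset.mem_singleton, forall_eq]
      refine ⟨?_, ?_, ?_, ?_⟩ <;>
        exact ⟨by norm_num, by linarith, by linarith [hb' hja, hb' hlt1]⟩
  · rw [hA, hB]
    clear hC h₃ h₂ h₁ h0 f1 f2 f3 f4 hA hB h4
    refine ⟨{(-1, 0), (-2, 0), (-3, 0)}, by decide, fun s z hz h5 h6 => ?_⟩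
    obtain ⟨h7, h8, h9⟩ := parameter_bounds (n := 4) (by linarith) (by linarith) (by linarith)
      (by linarith) (by linarith) (by linarith) hz h5 h6
    have hs := mul_nonneg (neg_nonneg.2 h8) (by linarith : 0 ≤ X + 2 * Y)
    have hz2 : z < 2 := by
      by_contra hz'
      linarith [mul_nonneg (by linarith : 0 ≤ 5 * X + 3 * Y) (by omega : 0 ≤ z - 2)]
    interval_cases s <;> interval_cases z <;>
      first | decide | (exfalso; linarith)

/-- The pair (1, 1) is available exactly when j ≥ f - a = 2X. The extremal residue is the last one
missing it, j = 2X - 1, whence U = j + 2a. -/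
theorem isPFrobeniusNumber_lucas_two_mul_add_three {i : ℕ} (hi : 3 ≤ i) :
    IsPFrobeniusNumber 3 ![lucas i, lucas (i + 2), lucas (2 * i + 3)]
      ((4 * Nat.fib (i + 1) - 1) * lucas (i + 2) - lucas i) := by
  obtain ⟨X, Y, h₃, h₂, h₁, h0, f1, f2, f3, f4, -, hA, hB, hY, hXY, hYX, h4⟩ :=
    exists_fib_lucas_coordinates hi
  have hC := lucas_add_eq_sub i (i + 3) (by omega)
  rw [show i + (i + 3) = 2 * i + 3 by omega, show i + 3 - 2 = i + 1 by omega, f3, f1] at hC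
  have hP : 0 ≤ 2 * Y - X := by linarith
  have hQ : 0 ≤ 2 * X - 3 * Y := by linarith
  have hPP := mul_nonneg hP hP
  have hPQ := mul_nonneg hP hQ
  have hQQ := mul_nonneg hQ hQ
  have hYY := mul_pos (by linarith : 0 < Y) (by linarith : 0 < Y)
  have hb : 0 ≤ 4 * X + 3 * Y := by linarith
  have key := isPFrobeniusNumber_of_criterion (p := 3) (U := 4 * (X + Y) - 1) (z₀ := 0)
    (lucas_pos i) (isCoprime_lucas_add_two i) hC ?_ ?_
  · convert key using 1
    rw [f1, hA, hB]
    ring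
  · rw [hA, hB]
    clear hC h₃ h₂ h₁ h0 f1 f2 f3 f4 hA hB h4
    have hb' {m n : ℤ} (h : m ≤ n) := mul_nonneg hb (sub_nonneg.2 h)
    intro j hj hja
    rcases le_or_gt (j + 2 * (X + 2 * Y)) (4 * (X + Y) - 1) with hge1 | hlt1
    · rcases le_or_gt (3 * X + 2 * Y) (j + 2 * (X + 2 * Y)) with hge2 | hlt2
      · refine ⟨{(0, 0), (1, 0), (2, 0), (2, 1)}, by decide, ?_⟩
        simp only [Finset.forall_mem_insert, Finset.mem_singleton, forall_eq]
        refine ⟨?_, ?_, ?_, ?_⟩ <;>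
          exact ⟨by norm_num, by linarith, by linarith [hb' hja, hb' hge1, hb' hge2]⟩
      · refine ⟨{(0, 0), (1, 0), (2, 0), (3, 1)}, by decide, ?_⟩
        simp only [Finset.forall_mem_insert, Finset.mem_singleton, forall_eq]
        refine ⟨?_, ?_, ?_, ?_⟩ <;>
          exact ⟨by norm_num, by linarith, by linarith [hb' hja, hb' hge1, hb' hlt2]⟩
    · refine ⟨{(0, 0), (1, 0), (1, 1), (2, 1)}, by decide, ?_⟩
      simp only [Finset.forall_mem_insert, Finset.mem_singleton, forall_eq]
      refine ⟨?_, ?_, ?_, ?_⟩ <;>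
        exact ⟨by norm_num, by linarith, by linarith [hb' hja, hb' hlt1]⟩
  · rw [hA, hB]
    clear hC h₃ h₂ h₁ h0 f1 f2 f3 f4 hA hB h4
    refine ⟨{(-1, 0), (-2, 0), (0, 1)}, by decide, fun s z hz h5 h6 => ?_⟩
    obtain ⟨h7, h8, h9⟩ := parameter_bounds (n := 3) (by linarith) (by linarith) (by linarith)
      (by linarith) (by linarith) (by linarith) hz h5 h6
    have hs := mul_nonneg (neg_nonneg.2 h8) (by linarith : 0 ≤ X + 2 * Y)
    have hz2 : z < 2 := by
      by_contra hz'
      linarith [mul_nonneg (by linarith : 0 ≤ 3 * X + 2 * Y) (by omega : 0 ≤ z - 2)]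
    interval_cases s <;> interval_cases z <;>
      first | decide | (exfalso; linarith)

/-- The extremal pair is (2, 2) at j = a - 1, where (0, 0), (1, 0) and (1, 1) are cheaper. -/
theorem isPFrobeniusNumber_lucas_two_mul_add_two {i : ℕ} (hi : 3 ≤ i) :
    IsPFrobeniusNumber 3 ![lucas i, lucas (i + 2), lucas (2 * i + 2)]
      ((Nat.fib i + 2 * Nat.fib (i - 3) - 1) * lucas (i + 2)
        + 2 * lucas (2 * i + 2) - lucas i) := by
  obtain ⟨X, Y, h₃, h₂, h₁, h0, f1, f2, f3, f4, -, hA, hB, hY, hXY, hYX, h4⟩ :=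
    exists_fib_lucas_coordinates hi
  have hC := lucas_add_eq_sub i (i + 2) (by omega)
  rw [show i + (i + 2) = 2 * i + 2 by omega, Nat.add_sub_cancel, f2, h0] at hC
  have hP : 0 ≤ 2 * Y - X := by linarith
  have hQ : 0 ≤ 2 * X - 3 * Y := by linarith
  have hPP := mul_nonneg hP hP
  have hPQ := mul_nonneg hP hQ
  have hQQ := mul_nonneg hQ hQ
  have hYY := mul_pos (by linarith : 0 < Y) (by linarith : 0 < Y)
  have hb : 0 ≤ 4 * X + 3 * Y := by linarith
  have key := isPFrobeniusNumber_of_criterion (p := 3) (U := 3 * (X + 2 * Y) - 1) (z₀ := 2)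
    (lucas_pos i) (isCoprime_lucas_add_two i) hC ?_ ?_
  · convert key using 1
    rw [h0, h₃, hC, hA, hB]
    ring
  · rw [hA, hB]
    clear hC h₃ h₂ h₁ h0 f1 f2 f3 f4 hA hB h4
    have hb' {m n : ℤ} (h : m ≤ n) := mul_nonneg hb (sub_nonneg.2 h)
    intro j hj hja
    rcases le_or_gt (2 * X + Y) (j + (X + 2 * Y)) with hge1 | hlt1
    · rcases le_or_gt (2 * (2 * X + Y)) (j + 2 * (X + 2 * Y)) with hge2 | hlt2
      · refine ⟨{(0, 0), (1, 0), (1, 1), (2, 2)}, by decide, ?_⟩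
        simp only [Finset.forall_mem_insert, Finset.mem_singleton, forall_eq]
        refine ⟨?_, ?_, ?_, ?_⟩ <;>
          exact ⟨by norm_num, by linarith, by linarith [hb' hja, hb' hge1, hb' hge2]⟩
      · refine ⟨{(0, 0), (1, 0), (1, 1), (2, 1)}, by decide, ?_⟩
        simp only [Finset.forall_mem_insert, Finset.mem_singleton, forall_eq]
        refine ⟨?_, ?_, ?_, ?_⟩ <;>
          exact ⟨by norm_num, by linarith, by linarith [hb' hja, hb' hge1, hb' hlt2]⟩
    · refine ⟨{(0, 0), (1, 0), (2, 0), (2, 1)}, by decide, ?_⟩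
      simp only [Finset.forall_mem_insert, Finset.mem_singleton, forall_eq]
      refine ⟨?_, ?_, ?_, ?_⟩ <;>
        exact ⟨by norm_num, by linarith, by linarith [hb' hja, hb' hlt1]⟩
  · rw [hA, hB]
    clear hC h₃ h₂ h₁ h0 f1 f2 f3 f4 hA hB h4
    refine ⟨{(-1, 0), (-1, 1), (-2, 0)}, by decide, fun s z hz h5 h6 => ?_⟩
    obtain ⟨h7, h8, h9⟩ := parameter_bounds (n := 3) (by linarith) (by linarith) (by linarith)
      (by linarith) (by linarith) (by linarith) hz h5 h6
    have hs := mul_nonneg (neg_nonneg.2 h8) (by linarith : 0 ≤ X + 2 * Y)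
    have hz2 : z < 3 := by
      by_contra hz'
      linarith [mul_nonneg (by linarith : 0 ≤ 2 * X + Y) (by omega : 0 ≤ z - 3)]
    interval_cases s <;> interval_cases z <;>
      first | decide | (exfalso; linarith)

/-- The extremal residue j = X - 1 is the last for which (1, 2) is unavailable, since 2f - a = X;
its fourth pair is (2, 3). -/
theorem isPFrobeniusNumber_lucas_two_mul_add_one {i : ℕ} (hi : 3 ≤ i) :
    IsPFrobeniusNumber 3 ![lucas i, lucas (i + 2), lucas (2 * i + 1)]
      ((Nat.fib (i - 1) - 1) * lucas (i + 2) + 3 * lucas (2 * i + 1) - lucas i) := by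
  obtain ⟨X, Y, h₃, h₂, h₁, h0, f1, f2, f3, f4, -, hA, hB, hY, hXY, hYX, h4⟩ :=
    exists_fib_lucas_coordinates hi
  have hC := lucas_add_eq_sub i (i + 1) (by omega)
  rw [show i + (i + 1) = 2 * i + 1 by omega, show i + 1 - 2 = i - 1 by omega, f1, h₁] at hC
  have hP : 0 ≤ 2 * Y - X := by linarith
  have hQ : 0 ≤ 2 * X - 3 * Y := by linarith
  have hPP := mul_nonneg hP hP
  have hPQ := mul_nonneg hP hQ
  have hQQ := mul_nonneg hQ hQ
  have hYY := mul_pos (by linarith : 0 < Y) (by linarith : 0 < Y)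
  have hb : 0 ≤ 4 * X + 3 * Y := by linarith
  have key := isPFrobeniusNumber_of_criterion (p := 3) (U := 3 * (X + Y) + Y - 1) (z₀ := 3)
    (lucas_pos i) (isCoprime_lucas_add_two i) hC ?_ ?_
  · convert key using 1
    rw [h₁, hC, hA, hB]
    ring
  · rw [hA, hB]
    clear hC h₃ h₂ h₁ h0 f1 f2 f3 f4 hA hB h4
    have hb' {m n : ℤ} (h : m ≤ n) := mul_nonneg hb (sub_nonneg.2 h)
    intro j hj hja
    rcases le_or_gt (X + Y) (j) with hge1 | hlt1
    · refine ⟨{(0, 0), (0, 1), (1, 1), (1, 2)}, by decide, ?_⟩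
      simp only [Finset.forall_mem_insert, Finset.mem_singleton, forall_eq]
      refine ⟨?_, ?_, ?_, ?_⟩ <;>
        exact ⟨by norm_num, by linarith, by linarith [hb' hja, hb' hge1]⟩
    · rcases le_or_gt (2 * (X + Y)) (j + (X + 2 * Y)) with hge2 | hlt2
      · refine ⟨{(0, 0), (1, 0), (1, 1), (1, 2)}, by decide, ?_⟩
        simp only [Finset.forall_mem_insert, Finset.mem_singleton, forall_eq]
        refine ⟨?_, ?_, ?_, ?_⟩ <;>
          exact ⟨by norm_num, by linarith, by linarith [hb' hja, hb' hlt1, hb' hge2]⟩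
      · rcases le_or_gt (3 * (X + Y)) (j + 2 * (X + 2 * Y)) with hge3 | hlt3
        · refine ⟨{(0, 0), (1, 0), (1, 1), (2, 3)}, by decide, ?_⟩
          simp only [Finset.forall_mem_insert, Finset.mem_singleton, forall_eq]
          refine ⟨?_, ?_, ?_, ?_⟩ <;>
            exact ⟨by norm_num, by linarith, by linarith [hb' hja, hb' hlt1, hb' hlt2, hb' hge3]⟩
        · refine ⟨{(0, 0), (1, 0), (1, 1), (2, 2)}, by decide, ?_⟩
          simp only [Finset.forall_mem_insert, Finset.mem_singleton, forall_eq]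
          refine ⟨?_, ?_, ?_, ?_⟩ <;>
            exact ⟨by norm_num, by linarith, by linarith [hb' hja, hb' hlt1, hb' hlt2, hb' hlt3]⟩
  · rw [hA, hB]
    clear hC h₃ h₂ h₁ h0 f1 f2 f3 f4 hA hB h4
    refine ⟨{(-1, 0), (-1, 1), (-2, 0)}, by decide, fun s z hz h5 h6 => ?_⟩
    obtain ⟨h7, h8, h9⟩ := parameter_bounds (n := 3) (by linarith) (by linarith) (by linarith)
      (by linarith) (by linarith) (by linarith) hz h5 h6
    have hs := mul_nonneg (neg_nonneg.2 h8) (by linarith : 0 ≤ X + 2 * Y)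
    have hz2 : z < 4 := by
      by_contra hz'
      linarith [mul_nonneg (by linarith : 0 ≤ X + Y) (by omega : 0 ≤ z - 4)]
    interval_cases s <;> interval_cases z <;>
      first | decide | (exfalso; linarith)

/-- The extremal pair is (1, 4) at j = a - 1. It requires 4X ≤ 2a - 1, that is X < 2Y, which fails
at i = 3. -/
theorem isPFrobeniusNumber_lucas_two_mul {i : ℕ} (hi : 4 ≤ i) :
    IsPFrobeniusNumber 3 ![lucas i, lucas (i + 2), lucas (2 * i)]
      ((2 * Nat.fib (i - 3) - 1) * lucas (i + 2) + 4 * lucas (2 * i) - lucas i) := by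
  obtain ⟨X, Y, h₃, h₂, h₁, h0, f1, f2, f3, f4, -, hA, hB, hY, hXY, hYX, h4⟩ :=
    exists_fib_lucas_coordinates (by omega : 3 ≤ i)
  have hC := lucas_add_eq_sub i (i) (by omega)
  rw [show i + (i) = 2 * i by omega, h0, h₂] at hC
  obtain ⟨hXY', hYX'⟩ := h4 hi
  -- The sharper ratio X/Y ≤ 5/3 gives X = 3P + 5Q and Y = 2P + 3Q.
  have hP : 0 ≤ 5 * Y - 3 * X := by linarith
  have hQ : 0 ≤ 2 * X - 3 * Y := by linarith
  have hPP := mul_nonneg hP hP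
  have hPQ := mul_nonneg hP hQ
  have hQQ := mul_nonneg hQ hQ
  have hYY := mul_pos (by linarith : 0 < Y) (by linarith : 0 < Y)
  have hb : 0 ≤ 4 * X + 3 * Y := by linarith
  have key := isPFrobeniusNumber_of_criterion (p := 3) (U := 2 * (X + 2 * Y) - 1) (z₀ := 4)
    (lucas_pos i) (isCoprime_lucas_add_two i) hC ?_ ?_
  · convert key using 1
    rw [h₃, hC, hA, hB]
    ring
  · rw [hA, hB]
    clear hC h₃ h₂ h₁ h0 f1 f2 f3 f4 hA hB h4
    have hb' {m n : ℤ} (h : m ≤ n) := mul_nonneg hb (sub_nonneg.2 h)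
    intro j hj hja
    rcases le_or_gt (2 * X) (j) with hge1 | hlt1
    · refine ⟨{(0, 0), (0, 1), (0, 2), (1, 4)}, by decide, ?_⟩
      simp only [Finset.forall_mem_insert, Finset.mem_singleton, forall_eq]
      refine ⟨?_, ?_, ?_, ?_⟩ <;>
        exact ⟨by norm_num, by linarith, by linarith [hb' hja, hb' hge1]⟩
    · rcases le_or_gt (X) (j) with hge2 | hlt2
      · rcases le_or_gt (4 * X) (j + (X + 2 * Y)) with hge3 | hlt3
        · refine ⟨{(0, 0), (0, 1), (1, 3), (1, 4)}, by decide, ?_⟩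
          simp only [Finset.forall_mem_insert, Finset.mem_singleton, forall_eq]
          refine ⟨?_, ?_, ?_, ?_⟩ <;>
            exact ⟨by norm_num, by linarith, by linarith [hb' hja, hb' hlt1, hb' hge2, hb' hge3]⟩
        · refine ⟨{(0, 0), (0, 1), (1, 2), (1, 3)}, by decide, ?_⟩
          simp only [Finset.forall_mem_insert, Finset.mem_singleton, forall_eq]
          refine ⟨?_, ?_, ?_, ?_⟩ <;>
            exact ⟨by norm_num, by linarith, by linarith [hb' hja, hb' hlt1, hb' hge2, hb' hlt3]⟩
      · refine ⟨{(0, 0), (1, 0), (1, 1), (1, 2)}, by decide, ?_⟩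
        simp only [Finset.forall_mem_insert, Finset.mem_singleton, forall_eq]
        refine ⟨?_, ?_, ?_, ?_⟩ <;>
          exact ⟨by norm_num, by linarith, by linarith [hb' hja, hb' hlt1, hb' hlt2]⟩
  · rw [hA, hB]
    clear hC h₃ h₂ h₁ h0 f1 f2 f3 f4 hA hB h4
    refine ⟨{(-1, 0), (-1, 1), (-1, 2)}, by decide, fun s z hz h5 h6 => ?_⟩
    obtain ⟨h7, h8, h9⟩ := parameter_bounds (n := 2) (by linarith) (by linarith) (by linarith)
      (by linarith) (by linarith) (by linarith) hz h5 h6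
    have hs := mul_nonneg (neg_nonneg.2 h8) (by linarith : 0 ≤ X + 2 * Y)
    have hz2 : z < 5 := by
      by_contra hz'
      linarith [mul_nonneg (by linarith : 0 ≤ X) (by omega : 0 ≤ z - 5)]
    interval_cases s <;> interval_cases z <;>
      first | decide | (exfalso; linarith)

/-- For (4, 11, 18) and U = 7, at most three copies of f = 2 fit, so z = 4 is impossible. The fourth
smallest cost occurs at z₀ = 2. -/
theorem isPFrobeniusNumber_lucas_three_five_six :
    IsPFrobeniusNumber 3 ![lucas 3, lucas 5, lucas 6] 65 := by
  have key := isPFrobeniusNumber_of_criterion (p := 3) (A := 4) (B := 11) (C := 18) (e := 1)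
    (f := 2) (U := 7) (z₀ := 2) (by norm_num) (isCoprime_lucas_add_two 3) (by norm_num) ?_ ?_
  · exact key
  · push_cast
    intro j hj hj4
    rcases lt_or_ge j 3 with h | h
    · refine ⟨{(0, 0), (1, 0), (1, 1), (1, 2)}, by decide, ?_⟩
      simp only [Finset.forall_mem_insert, Finset.mem_singleton, forall_eq]
      omega
    · refine ⟨{(0, 0), (0, 1), (1, 2), (1, 3)}, by decide, ?_⟩
      simp only [Finset.forall_mem_insert, Finset.mem_singleton, forall_eq]
      omega
  · push_cast
    refine ⟨{(0, 3), (-1, 0), (-1, 1)}, by decide, fun s z hz h1 h2 => ?_⟩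
    simp
    omega

theorem theorem8 (i : ℕ) (hi : 3 ≤ i) :
    (∀ k : ℕ, i + 5 ≤ k →
      IsPFrobeniusNumber 3 ![lucas i, lucas (i + 2), lucas (i + k)]
        ((4 * (lucas i : ℤ) - 1) * (lucas (i + 2) : ℤ) - (lucas i : ℤ))) ∧
    IsPFrobeniusNumber 3 ![lucas i, lucas (i + 2), lucas (2 * i + 4)]
      ((4 * (Nat.fib (i - 1) : ℤ) - (Nat.fib (i - 2) : ℤ) - 1) * (lucas (i + 2) : ℤ)
        + (lucas (2 * i + 4) : ℤ) - (lucas i : ℤ)) ∧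
    IsPFrobeniusNumber 3 ![lucas i, lucas (i + 2), lucas (2 * i + 3)]
      ((4 * (Nat.fib (i + 1) : ℤ) - 1) * (lucas (i + 2) : ℤ) - (lucas i : ℤ)) ∧
    IsPFrobeniusNumber 3 ![lucas i, lucas (i + 2), lucas (2 * i + 2)]
      (((Nat.fib i : ℤ) + 2 * (Nat.fib (i - 3) : ℤ) - 1) * (lucas (i + 2) : ℤ)
        + 2 * (lucas (2 * i + 2) : ℤ) - (lucas i : ℤ)) ∧
    IsPFrobeniusNumber 3 ![lucas i, lucas (i + 2), lucas (2 * i + 1)]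
      (((Nat.fib (i - 1) : ℤ) - 1) * (lucas (i + 2) : ℤ)
        + 3 * (lucas (2 * i + 1) : ℤ) - (lucas i : ℤ)) ∧
    (4 ≤ i →
      IsPFrobeniusNumber 3 ![lucas i, lucas (i + 2), lucas (2 * i)]
        ((2 * (Nat.fib (i - 3) : ℤ) - 1) * (lucas (i + 2) : ℤ)
          + 4 * (lucas (2 * i) : ℤ) - (lucas i : ℤ))) ∧
    (i = 3 →
      IsPFrobeniusNumber 3 ![lucas i, lucas (i + 2), lucas (2 * i)]
        (3 * (lucas (i + 2) : ℤ) + 2 * (lucas (2 * i) : ℤ) - (lucas i : ℤ)) ∧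
      3 * (lucas (i + 2) : ℤ) + 2 * (lucas (2 * i) : ℤ) - (lucas i : ℤ) = 65) ∧
    (∀ k r : ℕ, 3 ≤ k → r = (lucas i - 1) / Nat.fib k →
      (3 ≤ r ↔ k ≤ i - 1) ∧
      (3 ≤ r →
        (((lucas i : ℤ) - (r : ℤ) * (Nat.fib k : ℤ)) * (lucas (i + 2) : ℤ)
            ≥ (Nat.fib (k - 2) : ℤ) * (lucas i : ℤ) →
          IsPFrobeniusNumber 3 ![lucas i, lucas (i + 2), lucas (i + k)]
            (((lucas i : ℤ) - (r : ℤ) * (Nat.fib k : ℤ) - 1) * (lucas (i + 2) : ℤ)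
              + ((r : ℤ) + 3) * (lucas (i + k) : ℤ) - (lucas i : ℤ))) ∧
        (((lucas i : ℤ) - (r : ℤ) * (Nat.fib k : ℤ)) * (lucas (i + 2) : ℤ)
            < (Nat.fib (k - 2) : ℤ) * (lucas i : ℤ) →
          IsPFrobeniusNumber 3 ![lucas i, lucas (i + 2), lucas (i + k)]
            (((Nat.fib k : ℤ) - 1) * (lucas (i + 2) : ℤ)
              + ((r : ℤ) + 2) * (lucas (i + k) : ℤ) - (lucas i : ℤ))))) := by
  refine ⟨fun k hk => isPFrobeniusNumber_lucas_add_of_add_five_le hi hk,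
    isPFrobeniusNumber_lucas_two_mul_add_four hi, isPFrobeniusNumber_lucas_two_mul_add_three hi,
    isPFrobeniusNumber_lucas_two_mul_add_two hi, isPFrobeniusNumber_lucas_two_mul_add_one hi,
    fun hi4 => isPFrobeniusNumber_lucas_two_mul hi4, ?_, ?_⟩
  · rintro rfl
    exact ⟨isPFrobeniusNumber_lucas_three_five_six, rfl⟩
  · rintro k r hk rfl
    refine ⟨three_le_div_fib_iff hi hk, fun hr => ?_⟩
    have hf : 0 < Nat.fib k := Nat.fib_pos.2 (by omega)
    have hA := lucas_pos i
    have h1 := Nat.div_mul_le_self (lucas i - 1) (Nat.fib k)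
    have h2 := Nat.lt_mul_of_div_lt (Nat.lt_succ_self ((lucas i - 1) / Nat.fib k)) hf
    rw [Nat.succ_eq_add_one] at h2
    exact isPFrobeniusNumber_lucas_of_lt hi hk ((three_le_div_fib_iff hi hk).1 hr)
      (by exact_mod_cast hr) (by exact_mod_cast (by omega)) (by exact_mod_cast (by omega))
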